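/- Let $M$ be a compact connected smooth manifold, with or without boundary, let $F:TM\to[0,\infty)$ be a reversible Finsler metric on $M$ ($F$ is smooth on $TM\setminus\{0\}$, $F(x,cy)=|c|F(x,y)$ for all $c\in\mathbb R$, and the Hessian of $\tfrac12F(x,\cdot)^2$ is positive definite at every $y\neq0$), and let $\mathfrak m$ be a smooth measure on $M$ (in local coordinates $d\mathfrak m=\sigma\,dx^1\cdots dx^n$ with $\sigma$ smooth and positive). Put $F^*(\eta)=\sup_{X\neq 0}\eta(X)/F(X)$ for $\eta\in T^*M$. Let $\mathscr X$ be the completion of $C_0^\infty(M)$ (smooth functions with support disjoint from $\partial M$) with respect to the norm $\|u\|_{L^2(\mathfrak m)}+\|F^*(du)\|_{L^2(\mathfrak m)}$, and set $$E(u)=\frac{\int_M F^*(du)^2\,d\mathfrak m}{\int_M u^2\,d\mathfrak m}\quad(u\in\mathscr X\setminus\{0\}),\qquad \mathcal S=\Big\{u\in\mathscr X:\int_M u^2\,d\mathfrak m=1\Big\},\qquad \mathbb P(\mathscr X)=\mathcal S/\{\pm1\},$$ with the projection $\mathfrak p:\mathcal S\to\mathbb P(\mathscr X)$. Let $\mathscr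 C^1$ and $\mathscr C^2$ be the families of all closed and of all compact subsets of $\mathcal S$, respectively. For $A\subset\mathbb P(\mathscr X)$ let $\mathrm{cat}(A)$ be the smallest $k$ such that $A$ is covered by $k$ closed subsets of $\mathbb P(\mathscr X)$, each contractible in $\mathbb P(\mathscr X)$ (and $+\infty$ if there is no such $k$). Let $\mathrm{ess}(A)$ be the smallest $i$ for which there is a continuous $h:A\times[0,1]\to\mathbb P(\mathscr X)$ such that $h(\cdot,0)$ is the inclusion and $h(A,1)$ has Lebesgue covering dimension $i$ (and $+\infty$ if there is no such $i$), where $\mathrm{ess}(\emptyset)=-1$. For $A\subset\mathcal S$ put $\mathrm{Dim}_{LS}(A)=\mathrm{cat}(\mathfrak p(A))$ and $\mathrm{Dim}_{ES}(A)=\mathrm{ess}(\mathfrak p(A))+1$. For $\alpha\in\{1,2\}$, $D\in\{LS,ES\}$ and $k\geq1$ define $$\lambda_k^{D,\alpha}=\sup\Big\{\lambda\in[0,+\infty]:\ \sup\{\mathrm{Dim}_D(A):A\in\mathscr C^\alpha,\ E\leq\lambda\text{ on }A\}<k\Big\}.$$ Then for every integer $k\geq1$, $$\min\{\lambda_k^{LS,1},\,\lambda_k^{ES,1}\}\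 \leq\ \lambda_k^{ES,2}\ \leq\ \lambda_k^{LS,2}.$$ -/

import Mathlib

open Set Filter Topology MeasureTheory
open scoped Manifold ContDiff ENNReal

noncomputable section

section Topological

/-! ### Category, covering dimension and essential dimension in a topological space -/

variable {Y : Type*} [TopologicalSpace Y]

/-- The inclusion of a subset `A` of `Y`, as a continuous map. -/
def subsetIncl (A : Set Y) : C(A, Y) := ⟨Subtype.val, continuous_subtype_val⟩

/-- `A` is contractible in `Y`: the inclusion `A → Y` is homotopic to a constant map. -/
def ContractibleIn (A : Set Y) : Prop := (subsetIncl A).Nullhomotopic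

/-- The Lusternik-Schnirelmann category of `A` relative to `Y`: the smallest `k` such that `A` is
covered by `k` closed subsets of `Y`, each contractible in `Y` (and `⊤` if there is no such `k`). -/
def lsCat (A : Set Y) : ℕ∞ :=
  ⨅ (k : ℕ) (_ : ∃ C : Fin k → Set Y,
    (∀ j, IsClosed (C j) ∧ ContractibleIn (C j)) ∧ A ⊆ ⋃ j, C j), (k : ℕ∞)

/-- Lebesgue covering dimension at most `d`: every finite open cover has a finite open refinement
such that no point lies in more than `d + 1` of its members. -/
def CoveringDimLE (Z : Type*) [TopologicalSpace Z] (d : ℕ) : Prop :=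
  ∀ 𝒰 : Set (Set Z), 𝒰.Finite → (∀ U ∈ 𝒰, IsOpen U) → ⋃₀ 𝒰 = univ →
    ∃ 𝒱 : Set (Set Z), 𝒱.Finite ∧ (∀ V ∈ 𝒱, IsOpen V) ∧ ⋃₀ 𝒱 = univ ∧
      (∀ V ∈ 𝒱, ∃ U ∈ 𝒰, V ⊆ U) ∧ ∀ z : Z, {V ∈ 𝒱 | z ∈ V}.encard ≤ d + 1

open Classical in
/-- The Lebesgue covering dimension. The value `⊥` plays the role of the dimension `-1` of the
empty space. -/
def coveringDim (Z : Type*) [TopologicalSpace Z] : WithBot ℕ∞ :=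
  if IsEmpty Z then ⊥ else ((⨅ (d : ℕ) (_ : CoveringDimLE Z d), (d : ℕ∞) : ℕ∞) : WithBot ℕ∞)

/-- `A` is contractible in `Y` onto `B`: there is a homotopy `h : A × [0,1] → Y` such that
`h(·,0)` is the inclusion of `A` and `h(A,1) = B`. -/
def ContractibleOnto (A B : Set Y) : Prop :=
  ∃ f : C(A, Y), (subsetIncl A).Homotopic f ∧ range f = B

/-- The essential dimension of `A`: the smallest dimension of a subset of `Y` onto which `A` is
contractible in `Y`. Here `⊥` plays the role of `-1`, which is the value for `A = ∅`. -/
def essDim (A : Set Y) : WithBot ℕ∞ :=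
  ⨅ (B : Set Y) (_ : ContractibleOnto A B), coveringDim B

/-- `d ↦ d + 1`, where `⊥` plays the role of `-1`. -/
def addOne : WithBot ℕ∞ → ℕ∞
  | ⊥ => 0
  | (d : ℕ∞) => d + 1

end Topological

section Finsler

/-! ### Reversible Finsler metric measure manifolds -/

variable {n : ℕ} {H : Type*} [TopologicalSpace H]
  (I : ModelWithCorners ℝ (EuclideanSpace ℝ (Fin n)) H)
  (M : Type*) [TopologicalSpace M] [ChartedSpace H M] [IsManifold I ∞ M]

/-- A reversible Finsler metric on the manifold `M` (possibly with boundary). -/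
structure FinslerMetric where
  /-- The function `F : TM → [0, ∞)`. -/
  toFun : (x : M) → TangentSpace I x → ℝ
  nonneg : ∀ x v, 0 ≤ toFun x v
  smooth : ContMDiffOn I.tangent 𝓘(ℝ, ℝ) ∞ (fun w : TangentBundle I M ↦ toFun w.1 w.2)
    {w | w.2 ≠ 0}
  homogeneous : ∀ (x : M) (c : ℝ) (v : TangentSpace I x), toFun x (c • v) = |c| * toFun x v
  /-- Positive definiteness of the fundamental tensor `g_y = Hess (F² / 2)` at all `y ≠ 0`; note
  that `g_y(v, v)` is the second derivative of `t ↦ F(y + t v)² / 2` at `t = 0`. -/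
  posDef : ∀ (x : M) (y v : TangentSpace I x), y ≠ 0 → v ≠ 0 →
    0 < iteratedDeriv 2 (fun t : ℝ ↦ toFun x (y + t • v) ^ 2 / 2) 0

/-- A reversible Finsler manifold endowed with a smooth measure, that is, a measure which in local
coordinates is `σ(x) dx¹ ⋯ dxⁿ` with a smooth positive function `σ`. -/
structure FinslerMeasureManifold [MeasurableSpace M] extends FinslerMetric I M where
  measure : Measure M
  smooth_measure : ∀ p : M, ∃ σ : EuclideanSpace ℝ (Fin n) → ℝ,
    ContDiffOn ℝ ∞ σ (extChartAt I p).target ∧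
    (∀ y ∈ (extChartAt I p).target, 0 < σ y) ∧
    ∀ s ⊆ (extChartAt I p).source, MeasurableSet s →
      measure s = ∫⁻ y in extChartAt I p '' s, ENNReal.ofReal (σ y)

end Finsler

namespace FinslerMetric

variable {n : ℕ} {H : Type*} [TopologicalSpace H]
  {I : ModelWithCorners ℝ (EuclideanSpace ℝ (Fin n)) H}
  {M : Type*} [TopologicalSpace M] [ChartedSpace H M] [IsManifold I ∞ M]
  (F : FinslerMetric I M)

/-- The co-Finsler metric `F*(η) = sup_{v ≠ 0} η(v) / F(v)`. -/
def dual (x : M) (η : TangentSpace I x →L[ℝ] ℝ) : ℝ :=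
  ⨆ v : {v : TangentSpace I x // v ≠ 0}, η v / F.toFun x v

theorem pos {x : M} {v : TangentSpace I x} (hv : v ≠ 0) : 0 < F.toFun x v := by
  refine lt_of_le_of_ne (F.nonneg x v) fun h ↦ ?_
  have h1 := F.posDef x v v hv hv
  have h2 : (fun t : ℝ ↦ F.toFun x (v + t • v) ^ 2 / 2) = fun _ ↦ (0 : ℝ) := by
    funext t
    have : v + t • v = (1 + t) • v := by rw [add_smul, one_smul]
    rw [this, F.homogeneous, ← h]; simp
  rw [h2] at h1
  simp at h1

/-- The local expression of `η(v) / F(v)` in a trivialization of the tangent bundle. -/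
def ratio (η : (x : M) → TangentSpace I x →L[ℝ] ℝ) (p x : M) (y : EuclideanSpace ℝ (Fin n)) : ℝ :=
  η x ((trivializationAt (EuclideanSpace ℝ (Fin n)) (TangentSpace I) p).symm x y) /
    F.toFun x ((trivializationAt (EuclideanSpace ℝ (Fin n)) (TangentSpace I) p).symm x y)

theorem dual_image (η : (x : M) → TangentSpace I x →L[ℝ] ℝ) (p x : M)
    (hx : x ∈ (trivializationAt (EuclideanSpace ℝ (Fin n)) (TangentSpace I) p).baseSet) :
    range (fun v : {v : TangentSpace I x // v ≠ 0} ↦ η x v / F.toFun x v) =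
      F.ratio η p x '' Metric.sphere 0 1 := by
  set e := trivializationAt (EuclideanSpace ℝ (Fin n)) (TangentSpace I) p with he
  have hsymm : ∀ y, e.symm x y = (e.continuousLinearEquivAt ℝ x hx).symm y := fun y ↦ by
    rw [e.symm_continuousLinearEquivAt_eq hx, e.symmL_apply hx]
  ext r
  simp only [mem_range, mem_image, ratio, ← he, hsymm]
  constructor
  · rintro ⟨⟨v, hv⟩, rfl⟩
    set w := e.continuousLinearEquivAt ℝ x hx v with hw
    have hw0 : w ≠ 0 := (e.continuousLinearEquivAt ℝ x hx).map_ne_zero_iff.2 hv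
    have hv' : (e.continuousLinearEquivAt ℝ x hx).symm w = v :=
      (e.continuousLinearEquivAt ℝ x hx).symm_apply_apply v
    have hn : 0 < ‖w‖ := norm_pos_iff.2 hw0
    refine ⟨‖w‖⁻¹ • w, by simp [norm_smul, hn.ne'], ?_⟩
    rw [map_smul, hv', map_smul, F.homogeneous, abs_of_pos (inv_pos.2 hn), smul_eq_mul,
      mul_div_mul_left _ _ (inv_pos.2 hn).ne']
  · rintro ⟨y, hy, rfl⟩
    have hy0 : y ≠ 0 := by
      rintro rfl
      simp at hy
    exact ⟨⟨(e.continuousLinearEquivAt ℝ x hx).symm y,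
      (e.continuousLinearEquivAt ℝ x hx).symm.map_ne_zero_iff.2 hy0⟩, rfl⟩

theorem continuousOn_ratio {η : (x : M) → TangentSpace I x →L[ℝ] ℝ}
    (hη : Continuous fun w : TangentBundle I M ↦ η w.1 w.2) (p : M) :
    ContinuousOn (fun z : M × EuclideanSpace ℝ (Fin n) ↦ F.ratio η p z.1 z.2)
      ((trivializationAt (EuclideanSpace ℝ (Fin n)) (TangentSpace I) p).baseSet ×ˢ {0}ᶜ) := by
  set e := trivializationAt (EuclideanSpace ℝ (Fin n)) (TangentSpace I) p with he
  have hne : ∀ z ∈ e.baseSet ×ˢ ({0}ᶜ : Set (EuclideanSpace ℝ (Fin n))),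
      e.symm z.1 z.2 ≠ 0 := by
    rintro ⟨x, y⟩ ⟨hx, hy⟩
    have : e.symm x y = (e.continuousLinearEquivAt ℝ x hx).symm y := by
      rw [e.symm_continuousLinearEquivAt_eq hx, e.symmL_apply hx]
    simp only [this]
    exact (e.continuousLinearEquivAt ℝ x hx).symm.map_ne_zero_iff.2 hy
  have hc : ContinuousOn (fun z : M × EuclideanSpace ℝ (Fin n) ↦
      (⟨z.1, e.symm z.1 z.2⟩ : TangentBundle I M)) (e.baseSet ×ˢ {0}ᶜ) :=
    e.continuousOn_symm.mono (prod_mono le_rfl (subset_univ _))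
  have h1 : ContinuousOn (fun z : M × EuclideanSpace ℝ (Fin n) ↦ η z.1 (e.symm z.1 z.2))
      (e.baseSet ×ˢ {0}ᶜ) := hη.comp_continuousOn hc
  have h2 : ContinuousOn (fun z : M × EuclideanSpace ℝ (Fin n) ↦ F.toFun z.1 (e.symm z.1 z.2))
      (e.baseSet ×ˢ {0}ᶜ) := F.smooth.continuousOn.comp hc hne
  exact h1.div h2 fun z hz ↦ (F.pos (hne z hz)).ne'

theorem bddAbove_dual (x : M) (η : TangentSpace I x →L[ℝ] ℝ) :
    BddAbove (range fun v : {v : TangentSpace I x // v ≠ 0} ↦ η v / F.toFun x v) := by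
  set e := trivializationAt (EuclideanSpace ℝ (Fin n)) (TangentSpace I) x with he
  have hx : x ∈ e.baseSet := FiberBundle.mem_baseSet_trivializationAt' x
  have hsymm : ∀ y, e.symm x y = (e.continuousLinearEquivAt ℝ x hx).symm y := fun y ↦ by
    rw [e.symm_continuousLinearEquivAt_eq hx, e.symmL_apply hx]
  classical
  let η' : (z : M) → TangentSpace I z →L[ℝ] ℝ := fun z ↦ if h : z = x then h ▸ η else 0
  have hη' : η' x = η := by simp [η']
  have key := F.dual_image η' x x hx
  rw [hη'] at key
  rw [key]
  refine (IsCompact.image_of_continuousOn (isCompact_sphere _ _) ?_).bddAbove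
  have hmem : ∀ y ∈ Metric.sphere (0 : EuclideanSpace ℝ (Fin n)) 1, y ≠ 0 := by
    rintro y hy rfl
    simp at hy
  have hne : ∀ y ∈ Metric.sphere (0 : EuclideanSpace ℝ (Fin n)) 1, e.symm x y ≠ 0 := by
    intro y hy
    rw [hsymm]
    exact (e.continuousLinearEquivAt ℝ x hx).symm.map_ne_zero_iff.2 (hmem y hy)
  have hc : ContinuousOn (fun y : EuclideanSpace ℝ (Fin n) ↦
      (⟨x, e.symm x y⟩ : TangentBundle I M)) (Metric.sphere 0 1) :=
    e.continuousOn_symm.comp (f := fun y ↦ (x, y)) (by fun_prop) fun y _ ↦ ⟨hx, mem_univ _⟩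
  have h1 : ContinuousOn (fun y : EuclideanSpace ℝ (Fin n) ↦ η (e.symm x y))
      (Metric.sphere 0 1) := by
    have : (fun y ↦ η (e.symm x y)) =
        fun y ↦ η ((e.continuousLinearEquivAt ℝ x hx).symm y) := funext fun y ↦ by rw [hsymm]
    rw [this]
    exact (η.continuous.comp (e.continuousLinearEquivAt ℝ x hx).symm.continuous).continuousOn
  have h2 : ContinuousOn (fun y : EuclideanSpace ℝ (Fin n) ↦ F.toFun x (e.symm x y))
      (Metric.sphere 0 1) := F.smooth.continuousOn.comp hc hne
  have h3 : F.ratio η' x x = fun y ↦ η (e.symm x y) / F.toFun x (e.symm x y) := by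
    funext y
    simp only [ratio, hη', he]
  rw [h3]
  exact h1.div h2 fun z hz ↦ (F.pos (hne z hz)).ne'

theorem dual_nonneg (x : M) (η : TangentSpace I x →L[ℝ] ℝ) : 0 ≤ F.dual x η := by
  rcases isEmpty_or_nonempty {v : TangentSpace I x // v ≠ 0} with h | ⟨⟨v, hv⟩⟩
  · simp [dual]
  · have h1 : η v / F.toFun x v ≤ F.dual x η := le_ciSup (F.bddAbove_dual x η) ⟨v, hv⟩
    have h2 : η (-v) / F.toFun x (-v) ≤ F.dual x η :=
      le_ciSup (F.bddAbove_dual x η) ⟨-v, neg_ne_zero.2 hv⟩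
    have h3 : F.toFun x (-v) = F.toFun x v := by
      simpa using F.homogeneous x (-1) v
    rw [h3, map_neg, neg_div] at h2
    linarith

theorem dual_add_le (x : M) (η ξ : TangentSpace I x →L[ℝ] ℝ) :
    F.dual x (η + ξ) ≤ F.dual x η + F.dual x ξ := by
  rcases isEmpty_or_nonempty {v : TangentSpace I x // v ≠ 0} with h | h
  · simp [dual]
  · refine ciSup_le fun v ↦ ?_
    rw [add_apply, add_div]
    exact add_le_add (le_ciSup (F.bddAbove_dual x η) v) (le_ciSup (F.bddAbove_dual x ξ) v)

theorem dual_neg (x : M) (η : TangentSpace I x →L[ℝ] ℝ) : F.dual x (-η) = F.dual x η := by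
  unfold dual
  refine Equiv.iSup_congr ((Equiv.neg (TangentSpace I x)).subtypeEquiv fun v ↦ by simp) ?_
  rintro ⟨v, hv⟩
  have h3 : F.toFun x (-v) = F.toFun x v := by
    simpa using F.homogeneous x (-1) v
  simp [h3]

theorem dual_smul (x : M) (c : ℝ) (η : TangentSpace I x →L[ℝ] ℝ) :
    F.dual x (c • η) = |c| * F.dual x η := by
  have main : ∀ (c : ℝ), 0 ≤ c → ∀ η : TangentSpace I x →L[ℝ] ℝ,
      F.dual x (c • η) = c * F.dual x η := by
    intro c hc η
    unfold dual
    rw [Real.mul_iSup_of_nonneg hc]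
    simp [mul_div_assoc]
  rcases le_total 0 c with hc | hc
  · rw [abs_of_nonneg hc, main c hc]
  · rw [abs_of_nonpos hc, ← main (-c) (by linarith), ← F.dual_neg]
    congr 1
    ext v
    simp

theorem continuous_dual {η : (x : M) → TangentSpace I x →L[ℝ] ℝ}
    (hη : Continuous fun w : TangentBundle I M ↦ η w.1 w.2) :
    Continuous fun x ↦ F.dual x (η x) := by
  rw [continuous_iff_continuousAt]
  intro p
  set e := trivializationAt (EuclideanSpace ℝ (Fin n)) (TangentSpace I) p with he
  have hp : p ∈ e.baseSet := FiberBundle.mem_baseSet_trivializationAt' p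
  refine ContinuousOn.continuousAt (s := e.baseSet) ?_ (e.open_baseSet.mem_nhds hp)
  rw [continuousOn_iff_continuous_domRestrict]
  have h := F.continuousOn_ratio hη p
  let f : e.baseSet → Metric.sphere (0 : EuclideanSpace ℝ (Fin n)) 1 → ℝ :=
    fun x y ↦ F.ratio η p x y
  have hf : Continuous ↿f := by
    refine h.comp_continuous (f := fun z : e.baseSet × Metric.sphere
      (0 : EuclideanSpace ℝ (Fin n)) 1 ↦ ((z.1 : M), (z.2 : EuclideanSpace ℝ (Fin n))))
      (by fun_prop) ?_
    rintro ⟨⟨x, hx⟩, ⟨y, hy⟩⟩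
    refine ⟨hx, ?_⟩
    rintro rfl
    simp at hy
  have := IsCompact.continuous_sSup (isCompact_univ) hf
  convert this using 2 with x
  simp only [domRestrict_apply, dual, f, iSup]
  rw [F.dual_image η p x x.2]
  congr 1
  ext r
  simp

end FinslerMetric

namespace FinslerMeasureManifold

variable {n : ℕ} {H : Type*} [TopologicalSpace H]
  {I : ModelWithCorners ℝ (EuclideanSpace ℝ (Fin n)) H}
  {M : Type*} [TopologicalSpace M] [ChartedSpace H M] [IsManifold I ∞ M]
  [MeasurableSpace M] (𝓜 : FinslerMeasureManifold I M)

/-- `C₀^∞(M)`: the smooth functions on `M` with support disjoint from `∂M` (for compact `M`, these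
are the smooth functions with compact support in the interior, and all smooth functions if
`∂M = ∅`). -/
def testFunctions (I : ModelWithCorners ℝ (EuclideanSpace ℝ (Fin n)) H)
    (M : Type*) [TopologicalSpace M] [ChartedSpace H M] : Submodule ℝ (M → ℝ) where
  carrier := {φ | ContMDiff I 𝓘(ℝ, ℝ) ∞ φ ∧ Disjoint (tsupport φ) (I.boundary M)}
  zero_mem' := ⟨contMDiff_const, by simp [tsupport]⟩
  add_mem' := fun {φ ψ} hφ hψ ↦
    ⟨hφ.1.add hψ.1, (hφ.2.union_left hψ.2).mono_left (tsupport_add φ ψ)⟩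
  smul_mem' := fun c φ hφ ↦
    ⟨(contDiff_const_smul c).contMDiff.comp hφ.1, hφ.2.mono_left
      (closure_mono (Function.support_const_smul_subset c φ))⟩

/-- A synonym of `C₀^∞(M)`, which carries the norm `‖u‖_{L²} + ‖F*(du)‖_{L²}`. -/
def TestSpace (_ : FinslerMeasureManifold I M) : Type _ := testFunctions I M

instance : AddCommGroup 𝓜.TestSpace := inferInstanceAs (AddCommGroup (testFunctions I M))
instance : Module ℝ 𝓜.TestSpace := inferInstanceAs (Module ℝ (testFunctions I M))

/-- The function on `M` given by an element of `C₀^∞(M)`. -/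
def fn (φ : 𝓜.TestSpace) : M → ℝ := φ.1

theorem fn_add (φ ψ : 𝓜.TestSpace) : 𝓜.fn (φ + ψ) = 𝓜.fn φ + 𝓜.fn ψ := rfl
theorem fn_smul (c : ℝ) (φ : 𝓜.TestSpace) : 𝓜.fn (c • φ) = c • 𝓜.fn φ := rfl
theorem contMDiff_fn (φ : 𝓜.TestSpace) : ContMDiff I 𝓘(ℝ, ℝ) ∞ (𝓜.fn φ) :=
  (show φ.1 ∈ testFunctions I M from φ.2).1

/-- The differential `du` of a test function. -/
def d (φ : 𝓜.TestSpace) (x : M) : TangentSpace I x →L[ℝ] ℝ := mvfderiv I (𝓜.fn φ) x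

theorem mdiff_fn (φ : 𝓜.TestSpace) (x : M) : MDifferentiableAt I 𝓘(ℝ, ℝ) (𝓜.fn φ) x :=
  (𝓜.contMDiff_fn φ).mdifferentiable (by simp) x

theorem d_add (φ ψ : 𝓜.TestSpace) (x : M) : 𝓜.d (φ + ψ) x = 𝓜.d φ x + 𝓜.d ψ x := by
  unfold d
  rw [fn_add, mvfderiv_add (𝓜.mdiff_fn φ x) (𝓜.mdiff_fn ψ x)]

theorem d_smul (c : ℝ) (φ : 𝓜.TestSpace) (x : M) : 𝓜.d (c • φ) x = c • 𝓜.d φ x := by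
  unfold d
  have : 𝓜.fn (c • φ) = (fun _ : M ↦ c) • 𝓜.fn φ := rfl
  rw [this, mvfderiv_smul mdifferentiableAt_const (𝓜.mdiff_fn φ x), mvfderiv_const]
  ext v
  simp

theorem continuous_d (φ : 𝓜.TestSpace) :
    Continuous fun w : TangentBundle I M ↦ 𝓜.d φ w.1 w.2 := by
  have h1 := (𝓜.contMDiff_fn φ).continuous_tangentMap (by simp)
  have h2 := (contMDiff_snd_tangentBundle_modelSpace (n := 0) ℝ 𝓘(ℝ, ℝ)).continuous
  exact h2.comp h1

/-- The test function `u` as an element of `C(M)`. -/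
def toC (φ : 𝓜.TestSpace) : C(M, ℝ) := ⟨𝓜.fn φ, (𝓜.contMDiff_fn φ).continuous⟩

/-- The function `x ↦ F*(du(x))` for a test function `u`, as an element of `C(M)`. -/
def codiffC (φ : 𝓜.TestSpace) : C(M, ℝ) :=
  ⟨fun x ↦ 𝓜.dual x (𝓜.d φ x), 𝓜.continuous_dual (𝓜.continuous_d φ)⟩

theorem toC_add (φ ψ : 𝓜.TestSpace) : 𝓜.toC (φ + ψ) = 𝓜.toC φ + 𝓜.toC ψ := rfl
theorem toC_smul (c : ℝ) (φ : 𝓜.TestSpace) : 𝓜.toC (c • φ) = c • 𝓜.toC φ := rfl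

theorem abs_codiffC (φ : 𝓜.TestSpace) (x : M) : |𝓜.codiffC φ x| = 𝓜.codiffC φ x :=
  abs_of_nonneg (𝓜.dual_nonneg x _)

theorem codiffC_add_le (φ ψ : 𝓜.TestSpace) (x : M) :
    𝓜.codiffC (φ + ψ) x ≤ 𝓜.codiffC φ x + 𝓜.codiffC ψ x := by
  change 𝓜.dual x (𝓜.d (φ + ψ) x) ≤ _
  rw [d_add]
  exact 𝓜.dual_add_le x _ _

theorem codiffC_smul (c : ℝ) (φ : 𝓜.TestSpace) : 𝓜.codiffC (c • φ) = |c| • 𝓜.codiffC φ := by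
  ext x
  change 𝓜.dual x (𝓜.d (c • φ) x) = |c| * 𝓜.dual x (𝓜.d φ x)
  rw [d_smul, 𝓜.dual_smul]

variable [BorelSpace M]

instance : IsLocallyFiniteMeasure 𝓜.measure := by
  refine ⟨fun p ↦ ?_⟩
  obtain ⟨σ, hσ, -, hm⟩ := 𝓜.smooth_measure p
  set φ := extChartAt I p with hφ
  have hcont : ContinuousWithinAt σ φ.target (φ p) :=
    hσ.continuousOn _ (mem_extChartAt_target p)
  have hev : ∀ᶠ y in 𝓝[φ.target] (φ p), σ y < σ (φ p) + 1 :=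
    hcont.eventually (gt_mem_nhds (lt_add_one _))
  rw [eventually_nhdsWithin_iff, Metric.eventually_nhds_iff_ball] at hev
  obtain ⟨r, hr, hb⟩ := hev
  have hopen : IsOpen (φ.source ∩ φ ⁻¹' Metric.ball (φ p) r) :=
    (continuousOn_extChartAt p).isOpen_inter_preimage (isOpen_extChartAt_source p)
      Metric.isOpen_ball
  refine ⟨_, hopen.mem_nhds ⟨mem_extChartAt_source p, Metric.mem_ball_self hr⟩, ?_⟩
  rw [hm _ inter_subset_left hopen.measurableSet]
  have htm : MeasurableSet φ.target := by
    rw [hφ, extChartAt_target]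
    exact ((chartAt H p).open_target.preimage I.continuous_symm).measurableSet.inter
      I.isClosed_range.measurableSet
  calc ∫⁻ y in φ '' (φ.source ∩ φ ⁻¹' Metric.ball (φ p) r), ENNReal.ofReal (σ y)
      ≤ ∫⁻ y in φ.target ∩ Metric.ball (φ p) r, ENNReal.ofReal (σ y) := by
        refine lintegral_mono_set ?_
        rintro _ ⟨x, ⟨hx, hx'⟩, rfl⟩
        exact ⟨φ.map_source hx, hx'⟩
    _ ≤ ∫⁻ y in φ.target ∩ Metric.ball (φ p) r, ENNReal.ofReal (σ (φ p) + 1) :=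
        setLIntegral_mono' (htm.inter Metric.isOpen_ball.measurableSet) fun y hy ↦
          ENNReal.ofReal_le_ofReal (hb y hy.2 hy.1).le
    _ = ENNReal.ofReal (σ (φ p) + 1) * volume (φ.target ∩ Metric.ball (φ p) r) := by
        rw [setLIntegral_const]
    _ < ⊤ := ENNReal.mul_lt_top ENNReal.ofReal_lt_top
        ((measure_mono inter_subset_right).trans_lt Metric.isBounded_ball.measure_lt_top)

variable [CompactSpace M]

/-- The class of a continuous function in `L²(M)`. -/
def toL2 : C(M, ℝ) →L[ℝ] Lp ℝ 2 𝓜.measure := ContinuousMap.toLp 2 𝓜.measure ℝ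

theorem norm_toL2_mono {f g : C(M, ℝ)} (h : ∀ x, |f x| ≤ |g x|) : ‖𝓜.toL2 f‖ ≤ ‖𝓜.toL2 g‖ := by
  refine Lp.norm_le_norm_of_ae_le ?_
  filter_upwards [ContinuousMap.coeFn_toLp (p := 2) (𝕜 := ℝ) 𝓜.measure f,
    ContinuousMap.coeFn_toLp (p := 2) (𝕜 := ℝ) 𝓜.measure g] with x hf hg
  simp only [toL2]
  rw [hf, hg]
  exact h x

/-- The norm `‖u‖ = ‖u‖_{L²} + ‖F*(du)‖_{L²}` on `C₀^∞(M)`. -/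
def h1Seminorm : Seminorm ℝ 𝓜.TestSpace :=
  Seminorm.of (fun φ ↦ ‖𝓜.toL2 (𝓜.toC φ)‖ + ‖𝓜.toL2 (𝓜.codiffC φ)‖)
    (fun φ ψ ↦ by
      have h1 : ‖𝓜.toL2 (𝓜.toC (φ + ψ))‖ ≤ ‖𝓜.toL2 (𝓜.toC φ)‖ + ‖𝓜.toL2 (𝓜.toC ψ)‖ := by
        rw [toC_add, map_add]
        exact norm_add_le _ _
      have h2 : ‖𝓜.toL2 (𝓜.codiffC (φ + ψ))‖ ≤
          ‖𝓜.toL2 (𝓜.codiffC φ)‖ + ‖𝓜.toL2 (𝓜.codiffC ψ)‖ := by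
        refine (𝓜.norm_toL2_mono (g := 𝓜.codiffC φ + 𝓜.codiffC ψ) fun x ↦ ?_).trans ?_
        · rw [abs_codiffC]
          exact (𝓜.codiffC_add_le φ ψ x).trans (le_abs_self _)
        · rw [map_add]
          exact norm_add_le _ _
      linarith)
    (fun c φ ↦ by
      rw [toC_smul, codiffC_smul, map_smul, map_smul, norm_smul, norm_smul, norm_abs_eq_norm,
        mul_add])

instance : SeminormedAddCommGroup 𝓜.TestSpace :=
  𝓜.h1Seminorm.toAddGroupSeminorm.toSeminormedAddCommGroup

theorem norm_def (φ : 𝓜.TestSpace) :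
    ‖φ‖ = ‖𝓜.toL2 (𝓜.toC φ)‖ + ‖𝓜.toL2 (𝓜.codiffC φ)‖ := rfl

instance : NormedSpace ℝ 𝓜.TestSpace where
  norm_smul_le c φ := (map_smul_eq_mul 𝓜.h1Seminorm c φ).le

/-- The Sobolev space `𝒳`, the completion of `C₀^∞(M)` for the norm
`‖u‖_{L²} + ‖F*(du)‖_{L²}`. -/
abbrev SobolevSpace : Type _ := UniformSpace.Completion 𝓜.TestSpace

theorem uniformContinuous_toL2_toC :
    UniformContinuous fun φ : 𝓜.TestSpace ↦ 𝓜.toL2 (𝓜.toC φ) := by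
  refine (LipschitzWith.of_dist_le_mul (K := 1) fun φ ψ ↦ ?_).uniformContinuous
  have : 𝓜.toC φ - 𝓜.toC ψ = 𝓜.toC (φ - ψ) := rfl
  rw [dist_eq_norm, dist_eq_norm, ← map_sub, this, norm_def, NNReal.coe_one, one_mul]
  exact le_add_of_nonneg_right (norm_nonneg _)

theorem uniformContinuous_toL2_codiffC :
    UniformContinuous fun φ : 𝓜.TestSpace ↦ 𝓜.toL2 (𝓜.codiffC φ) := by
  refine (LipschitzWith.of_dist_le_mul (K := 1) fun φ ψ ↦ ?_).uniformContinuous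
  rw [dist_eq_norm, dist_eq_norm, ← map_sub, norm_def, NNReal.coe_one, one_mul]
  refine (𝓜.norm_toL2_mono (g := 𝓜.codiffC (φ - ψ)) fun x ↦ ?_).trans
    (le_add_of_nonneg_left (norm_nonneg _))
  rw [abs_codiffC, ContinuousMap.sub_apply, abs_le]
  have h1 := 𝓜.codiffC_add_le (φ - ψ) ψ x
  have h2 := 𝓜.codiffC_add_le (ψ - φ) φ x
  have h3 : 𝓜.codiffC (ψ - φ) = 𝓜.codiffC (φ - ψ) := by
    have := 𝓜.codiffC_smul (-1) (φ - ψ)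
    simpa using this
  rw [sub_add_cancel] at h1 h2
  rw [h3] at h2
  constructor <;> linarith

/-- The element of `L²(M)` given by `u ∈ 𝒳` (continuous extension from `C₀^∞(M)`). -/
def valL2 : 𝓜.SobolevSpace → Lp ℝ 2 𝓜.measure :=
  UniformSpace.Completion.extension fun φ ↦ 𝓜.toL2 (𝓜.toC φ)

/-- The function `F*(du)` in `L²(M)` of `u ∈ 𝒳` (continuous extension from `C₀^∞(M)`). -/
def codiffL2 : 𝓜.SobolevSpace → Lp ℝ 2 𝓜.measure :=
  UniformSpace.Completion.extension fun φ ↦ 𝓜.toL2 (𝓜.codiffC φ)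

theorem valL2_coe (φ : 𝓜.TestSpace) : 𝓜.valL2 φ = 𝓜.toL2 (𝓜.toC φ) :=
  UniformSpace.Completion.extension_coe 𝓜.uniformContinuous_toL2_toC φ

theorem codiffL2_coe (φ : 𝓜.TestSpace) : 𝓜.codiffL2 φ = 𝓜.toL2 (𝓜.codiffC φ) :=
  UniformSpace.Completion.extension_coe 𝓜.uniformContinuous_toL2_codiffC φ

/-- The canonical energy functional `E(u) = ∫ F*(du)² dm / ∫ u² dm`. -/
def energy (u : 𝓜.SobolevSpace) : ℝ :=
  (∫ x, (𝓜.codiffL2 u x) ^ 2 ∂𝓜.measure) / ∫ x, (𝓜.valL2 u x) ^ 2 ∂𝓜.measure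

/-- The set `𝒮` of all `u ∈ 𝒳` with `∫ u² dm = 1`, with the topology of `𝒳`. -/
abbrev UnitSphere : Type _ := {u : 𝓜.SobolevSpace // ∫ x, (𝓜.valL2 u x) ^ 2 ∂𝓜.measure = 1}

/-- The antipodal relation `v = ± u` on `𝒮`. -/
def antipodal : Setoid 𝓜.UnitSphere where
  r u v := (v : 𝓜.SobolevSpace) = u ∨ (v : 𝓜.SobolevSpace) = -u
  iseqv :=
    { refl := fun _ ↦ Or.inl rfl
      symm := by
        rintro u v (h | h)
        · exact Or.inl h.symm
        · exact Or.inr (by rw [h, neg_neg])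
      trans := by
        rintro u v w (h | h) (h' | h')
        · exact Or.inl (h'.trans h)
        · exact Or.inr (by rw [h', h])
        · exact Or.inr (by rw [h', h])
        · exact Or.inl (by rw [h', h, neg_neg]) }

/-- The projective space `ℙ(𝒳) = 𝒮 / ℤ₂`, with the quotient topology. -/
abbrev ProjectiveSpace : Type _ := Quotient 𝓜.antipodal

/-- The projection `𝒮 → ℙ(𝒳)`. -/
def proj (u : 𝓜.UnitSphere) : 𝓜.ProjectiveSpace := Quotient.mk 𝓜.antipodal u

/-- The family `𝒞¹` of all closed subsets of `𝒮`. -/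
def closedFamily : Set (Set 𝓜.UnitSphere) := {A | IsClosed A}

/-- The family `𝒞²` of all compact subsets of `𝒮`. -/
def compactFamily : Set (Set 𝓜.UnitSphere) := {A | IsCompact A}

/-- The Lusternik-Schnirelmann dimension: the category of the image of `A` in `ℙ(𝒳)`. -/
def dimLS (A : Set 𝓜.UnitSphere) : ℕ∞ := lsCat (𝓜.proj '' A)

/-- The essential dimension of `A ⊆ 𝒮`: one plus that of the image of `A` in `ℙ(𝒳)`. -/
def dimES (A : Set 𝓜.UnitSphere) : ℕ∞ := addOne (essDim (𝓜.proj '' A))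

/-- `Dim E⁻¹[0, c]`, the supremum of `Dim A` over all `A ∈ 𝒞` with `A ⊆ E⁻¹[0, c]`. -/
def dimSublevel (𝒞 : Set (Set 𝓜.UnitSphere)) (Dim : Set 𝓜.UnitSphere → ℕ∞) (c : ℝ≥0∞) : ℕ∞ :=
  ⨆ A ∈ {A ∈ 𝒞 | ∀ u ∈ A, ENNReal.ofReal (𝓜.energy u) ≤ c}, Dim A

/-- The `k`-th eigenvalue `sup {c ∈ [0, ∞] : Dim E⁻¹[0, c] < k}` of the pair `(𝒞, Dim)`. -/
def eigenvalue (𝒞 : Set (Set 𝓜.UnitSphere)) (Dim : Set 𝓜.UnitSphere → ℕ∞) (k : ℕ) : ℝ≥0∞ :=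
  sSup {c : ℝ≥0∞ | 𝓜.dimSublevel 𝒞 Dim c < k}

end FinslerMeasureManifold

end

/-!
The first inequality only uses the essential dimension: compact subsets of `𝒮` are closed, so
passing from closed to compact sets can only increase the eigenvalues
(`FinslerMeasureManifold.eigenvalue_le_eigenvalue`).

The second inequality says that `cat(𝔭(A)) ≤ ess(𝔭(A)) + 1` for compact `A`
(`lsCat_le_addOne_essDim`). Let `f` be homotopic to the inclusion of `𝔭(A)`, with image `B` of
covering dimension `d`. A closed cover of `B` by sets contractible in the projective space pulls
back along `f` to such a cover of `𝔭(A)` (`lsCat_le_of_homotopic`), so it is enough to cover `B` by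
`d + 1` sets (`lsCat_le_of_coveringDimLE`). By Ostrand's argument
(`CoveringDimLE.exists_disjoint_closed_cover`), a finite cover of `B` by open sets contractible in
the ambient space has a closed refinement made of `d + 1` finite families of pairwise disjoint
sets. The union of one such family is contractible in the ambient space, because that space is
path-connected (`ContractibleIn.iUnion`).

Of the projective space this needs that it is Hausdorff, path-connected
(`FinslerMeasureManifold.joined_proj`) and covered by open sets contractible in it
(`FinslerMeasureManifold.exists_open_contractibleIn`). The last two hold because segments in `𝒳`
that avoid the kernel of `𝒳 → L²(M)` project to paths; the geometry of `M` plays no role.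
-/

section Topological

open scoped unitInterval

variable {Y : Type*} [TopologicalSpace Y]

/-! ### Sets contractible in a space -/

theorem ContractibleIn.mono {A B : Set Y} (hB : ContractibleIn B) (h : A ⊆ B) :
    ContractibleIn A :=
  hB.comp_left ⟨inclusion h, continuous_inclusion h⟩

/-- In a path-connected space the constant at the end of a contraction may be prescribed, and a
contraction of `C` may be described by a map on all of `Y × I` that is continuous over `C`. -/
theorem contractibleIn_iff_continuousOn [PathConnectedSpace Y] {C : Set Y} (y₀ : Y) :
    ContractibleIn C ↔ ∃ G : Y × I → Y, ContinuousOn G (C ×ˢ univ) ∧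
      (∀ x ∈ C, G (x, 0) = x) ∧ ∀ x ∈ C, G (x, 1) = y₀ := by
  classical
  constructor
  · rintro ⟨y, hy⟩
    have hconst : (ContinuousMap.const C y).Homotopic (ContinuousMap.const C y₀) := by
      let γ := PathConnectedSpace.somePath y y₀
      exact ⟨{ toFun := fun z ↦ γ z.1
               continuous_toFun := by fun_prop
               map_zero_left := by simp
               map_one_left := by simp }⟩
    obtain ⟨h⟩ := hy.trans hconst
    refine ⟨fun z ↦ if hz : z.1 ∈ C then h (z.2, ⟨z.1, hz⟩) else z.1, ?_, ?_, ?_⟩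
    · rw [continuousOn_iff_continuous_domRestrict]
      have : Continuous fun z : (C ×ˢ (univ : Set I) : Set (Y × I)) ↦
          h (z.1.2, ⟨z.1.1, z.2.1⟩) := by fun_prop
      convert this using 2 with z
      simp [z.2.1]
    · intro x hx
      simp only [dif_pos hx]
      exact h.apply_zero _
    · intro x hx
      simp [hx]
  · rintro ⟨G, hG, h0, h1⟩
    refine ⟨y₀, ⟨{ toFun := fun z ↦ G (z.2, z.1)
                   continuous_toFun := ?_
                   map_zero_left := fun x ↦ h0 x x.2
                   map_one_left := fun x ↦ h1 x x.2 }⟩⟩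
    exact hG.comp_continuous (f := fun z : I × C ↦ ((z.2 : Y), z.1)) (by fun_prop)
      fun z ↦ ⟨z.2.2, mem_univ _⟩

/-- Over the disjoint pieces the contractions to a common point fit together. -/
theorem ContractibleIn.iUnion [PathConnectedSpace Y] {ι : Type*} [Finite ι] {C : ι → Set Y}
    (hcl : ∀ i, IsClosed (C i)) (hC : ∀ i, ContractibleIn (C i))
    (hdisj : Pairwise (Function.onFun Disjoint C)) : ContractibleIn (⋃ i, C i) := by
  classical
  obtain ⟨y₀⟩ := (inferInstance : Nonempty Y)
  choose G hG h0 h1 using fun i ↦ (contractibleIn_iff_continuousOn y₀).1 (hC i)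
  let K : Y × I → Y := fun z ↦ if h : ∃ i, z.1 ∈ C i then G h.choose z else z.1
  have hK : ∀ i, ∀ z : Y × I, z.1 ∈ C i → K z = G i z := by
    intro i z hz
    have h : ∃ i, z.1 ∈ C i := ⟨i, hz⟩
    have : h.choose = i := by
      by_contra hne
      exact disjoint_left.1 (hdisj hne) h.choose_spec hz
    simp only [K, dif_pos h, this]
  refine (contractibleIn_iff_continuousOn y₀).2 ⟨K, ?_, ?_, ?_⟩
  · rw [iUnion_prod_const]
    refine (locallyFinite_of_finite _).continuousOn_iUnion
      (fun i ↦ (hcl i).prod isClosed_univ) fun i ↦ (hG i).congr fun z hz ↦ hK i z hz.1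
  · intro x hx
    obtain ⟨i, hi⟩ := mem_iUnion.1 hx
    rw [hK i _ hi, h0 i x hi]
  · intro x hx
    obtain ⟨i, hi⟩ := mem_iUnion.1 hx
    rw [hK i _ hi, h1 i x hi]

/-! ### Closed covers from the covering dimension -/

/-- Ostrand's decomposition: in a normal space of covering dimension at most `d`, every finite
open cover is refined by a closed cover that splits into `d + 1` finite families, each consisting
of pairwise disjoint sets. -/
theorem CoveringDimLE.exists_disjoint_closed_cover.{u} {Z : Type u} [TopologicalSpace Z] [NormalSpace Z]
    {d : ℕ} (hd : CoveringDimLE Z d) {𝒰 : Set (Set Z)} (hfin : 𝒰.Finite)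
    (hopen : ∀ U ∈ 𝒰, IsOpen U) (hcov : ⋃₀ 𝒰 = univ) :
    ∃ (ι : Fin (d + 1) → Type u) (_ : ∀ j, Finite (ι j)) (C : (j : Fin (d + 1)) → ι j → Set Z),
      (∀ j i, IsClosed (C j i)) ∧ (∀ j i, ∃ U ∈ 𝒰, C j i ⊆ U) ∧
      (∀ j, Pairwise (Function.onFun Disjoint (C j))) ∧ ∀ z, ∃ j i, z ∈ C j i := by
  classical
  obtain ⟨𝒱, hVfin, hVopen, hVcov, href, hord⟩ := hd 𝒰 hfin hopen hcov
  have := hVfin.fintype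
  obtain ⟨f, hf⟩ := PartitionOfUnity.exists_isSubordinate_of_locallyFinite (s := (univ : Set Z))
    isClosed_univ (fun V : 𝒱 ↦ (V : Set Z)) (fun V ↦ hVopen V V.2) (locallyFinite_of_finite _)
    (by rw [← sUnion_eq_iUnion, hVcov])
  have hsub : ∀ (V : 𝒱) (z : Z), 0 < f V z → z ∈ (V : Set Z) := fun V z h ↦
    hf V (subset_tsupport _ h.ne')
  -- On `W s` the functions indexed by `s` strictly dominate the other ones, so that the sets
  -- `W s` with `s` of a given cardinality are pairwise disjoint.
  let W : Finset 𝒱 → Set Z := fun s ↦ ⋂ V ∈ s, {z | 0 < f V z ∧ ∀ V' ∉ s, f V' z < f V z}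
  have hWmem : ∀ s z, z ∈ W s ↔ ∀ V ∈ s, 0 < f V z ∧ ∀ V' ∉ s, f V' z < f V z := by
    simp [W]
  have hWopen : ∀ s, IsOpen (W s) := by
    intro s
    refine isOpen_biInter_finset fun V _ ↦ ?_
    simp only [ofPred_and, ofPred_forall]
    refine (isOpen_lt continuous_const (f V).continuous).inter ?_
    exact isOpen_iInter_of_finite fun V' ↦ isOpen_iInter_of_finite fun _ ↦
      isOpen_lt (f V').continuous (f V).continuous
  let κ := {s : Finset 𝒱 // s.Nonempty ∧ s.card ≤ d + 1}
  have hWcov : ⋃ s : κ, W s.1 = univ := by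
    refine eq_univ_of_forall fun z ↦ ?_
    obtain ⟨V₀, hV₀⟩ := f.exists_pos (mem_univ z)
    obtain ⟨Vm, -, hVm⟩ := Finset.exists_max_image Finset.univ (fun V ↦ f V z) ⟨V₀, by simp⟩
    -- The functions attaining the maximum at `z`.
    let s : Finset 𝒱 := Finset.univ.filter fun V ↦ f V z = f Vm z
    have hpos : ∀ V ∈ s, 0 < f V z := by
      intro V hV
      rw [(Finset.mem_filter.1 hV).2]
      exact hV₀.trans_le (hVm V₀ (Finset.mem_univ _))
    have hcard : s.card ≤ d + 1 := by
      have h1 : Subtype.val '' (s : Set 𝒱) ⊆ {V ∈ 𝒱 | z ∈ V} := by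
        rintro _ ⟨V, hV, rfl⟩
        exact ⟨V.2, hsub V z (hpos V hV)⟩
      have h2 := (encard_le_encard h1).trans (hord z)
      rw [Subtype.val_injective.encard_image, encard_coe_eq_coe_finsetCard] at h2
      exact_mod_cast h2
    refine mem_iUnion.2 ⟨⟨s, ⟨Vm, by simp [s]⟩, hcard⟩, (hWmem s z).2 fun V hV ↦ ⟨hpos V hV, ?_⟩⟩
    intro V' hV'
    have h1 : f V z = f Vm z := (Finset.mem_filter.1 hV).2
    have h2 : f V' z ≠ f Vm z := by simpa [s] using hV'
    rw [h1]
    exact lt_of_le_of_ne (hVm V' (Finset.mem_univ _)) h2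
  obtain ⟨C, hCcov, hCcl, hCW⟩ := exists_iUnion_eq_closed_subset (fun s : κ ↦ hWopen s.1)
    (fun _ ↦ toFinite _) hWcov
  refine ⟨fun j ↦ {s : κ // s.1.card = j + 1}, fun j ↦ inferInstance, fun j s ↦ C s.1,
    fun j s ↦ hCcl _, ?_, ?_, ?_⟩
  · rintro j ⟨s, -⟩
    obtain ⟨V, hV⟩ := s.2.1
    obtain ⟨U, hU, hVU⟩ := href V V.2
    exact ⟨U, hU, fun z hz ↦ hVU (hsub V z ((hWmem _ _).1 (hCW s hz) V hV).1)⟩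
  · rintro j ⟨s, hs⟩ ⟨t, ht⟩ hne
    refine disjoint_left.2 fun z hzs hzt ↦ hne ?_
    have hs' := (hWmem _ _).1 (hCW s hzs)
    have ht' := (hWmem _ _).1 (hCW t hzt)
    have hcard : s.1.card = t.1.card := hs.trans ht.symm
    -- Two distinct sets of equal cardinality have elements outside each other.
    by_contra hst
    have hst' : s.1 ≠ t.1 := fun h ↦ hst (Subtype.ext (Subtype.ext h))
    obtain ⟨V, hVs, hVt⟩ := Finset.not_subset.1
      fun h ↦ hst' (Finset.eq_of_subset_of_card_le h hcard.ge)
    obtain ⟨V', hVt', hVs'⟩ := Finset.not_subset.1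
      fun h ↦ hst' (Finset.eq_of_subset_of_card_le h hcard.le).symm
    exact lt_asymm ((hs' V hVs).2 V' hVs') ((ht' V' hVt').2 V hVt)
  · intro z
    obtain ⟨s, hs⟩ := mem_iUnion.1 (hCcov ▸ mem_univ z : z ∈ ⋃ s, C s)
    have h1 := s.2.1.card_pos
    have h2 := s.2.2
    exact ⟨⟨s.1.card - 1, by omega⟩, ⟨s, by simp only; omega⟩, hs⟩

/-! ### Category and essential dimension -/

theorem lsCat_le_of_cover {A : Set Y} {k : ℕ} (C : Fin k → Set Y)
    (hC : ∀ j, IsClosed (C j) ∧ ContractibleIn (C j)) (hA : A ⊆ ⋃ j, C j) : lsCat A ≤ k :=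
  iInf₂_le k ⟨C, hC, hA⟩

/-- The category of a compact set does not exceed that of a set onto which it is deformed:
a closed cover of the latter by contractible sets is pulled back along the deformation. -/
theorem lsCat_le_of_homotopic [T2Space Y] {A : Set Y} (hA : IsCompact A) {f : C(A, Y)}
    (hf : (subsetIncl A).Homotopic f) : lsCat A ≤ lsCat (range f) := by
  refine le_iInf₂ fun k ⟨C, hC, hcov⟩ ↦ ?_
  have := isCompact_iff_compactSpace.1 hA
  refine lsCat_le_of_cover (fun j ↦ Subtype.val '' (f ⁻¹' C j)) (fun j ↦ ⟨?_, ?_⟩) ?_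
  · exact (((hC j).1.preimage f.continuous).isCompact.image continuous_subtype_val).isClosed
  · set S : Set Y := Subtype.val '' (f ⁻¹' C j)
    have hSA : S ⊆ A := Subtype.coe_image_subset _ _
    let ι : C(S, A) := ⟨inclusion hSA, continuous_inclusion hSA⟩
    have hmem : ∀ x : S, f (ι x) ∈ C j := by
      rintro ⟨_, x, hx, rfl⟩
      exact hx
    let g : C(S, C j) := ⟨fun x ↦ ⟨f (ι x), hmem x⟩, by fun_prop⟩
    obtain ⟨y, hy⟩ := (hC j).2.comp_left g
    exact ⟨y, (hf.comp (ContinuousMap.Homotopic.refl ι)).trans hy⟩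
  · intro x hx
    obtain ⟨j, hj⟩ := mem_iUnion.1 (hcov (mem_range_self ⟨x, hx⟩))
    exact mem_iUnion.2 ⟨j, ⟨x, hx⟩, hj, rfl⟩

/-- A compact set of covering dimension at most `d` in a path-connected space that is locally
contractible in itself has category at most `d + 1`. -/
theorem lsCat_le_of_coveringDimLE [T2Space Y] [PathConnectedSpace Y]
    (hloc : ∀ y : Y, ∃ U, IsOpen U ∧ y ∈ U ∧ ContractibleIn U) {B : Set Y} (hB : IsCompact B)
    {d : ℕ} (hd : CoveringDimLE B d) : lsCat B ≤ (d + 1 : ℕ) := by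
  have := isCompact_iff_compactSpace.1 hB
  choose U hUo hyU hUc using hloc
  obtain ⟨t, ht⟩ := hB.elim_finite_subcover U hUo fun y _ ↦ mem_iUnion.2 ⟨y, hyU y⟩
  obtain ⟨ι, hι, C, hCcl, hCU, hCd, hCcov⟩ := hd.exists_disjoint_closed_cover
    (𝒰 := (fun y ↦ (Subtype.val ⁻¹' U y : Set B)) '' t) (t.finite_toSet.image _)
    (by rintro _ ⟨y, -, rfl⟩; exact (hUo y).preimage continuous_subtype_val)
    (eq_univ_of_forall fun x ↦ by
      obtain ⟨y, hy, hxy⟩ := mem_iUnion₂.1 (ht x.2)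
      exact ⟨_, ⟨y, hy, rfl⟩, hxy⟩)
  have hcl : ∀ j i, IsClosed (Subtype.val '' C j i) := fun j i ↦
    ((hCcl j i).isCompact.image continuous_subtype_val).isClosed
  refine lsCat_le_of_cover (fun j ↦ ⋃ i, Subtype.val '' C j i)
    (fun j ↦ ⟨isClosed_iUnion_of_finite (hcl j), ?_⟩) ?_
  · refine ContractibleIn.iUnion (hcl j) (fun i ↦ ?_) fun i i' hne ↦
      disjoint_image_of_injective Subtype.val_injective (hCd j hne)
    obtain ⟨_, ⟨y, -, rfl⟩, hy⟩ := hCU j i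
    exact (hUc y).mono (image_subset_iff.2 hy)
  · intro x hx
    obtain ⟨j, i, h⟩ := hCcov ⟨x, hx⟩
    exact mem_iUnion₂.2 ⟨j, i, ⟨x, hx⟩, h, rfl⟩

theorem lsCat_le_of_essDim_lt [T2Space Y] [PathConnectedSpace Y]
    (hloc : ∀ y : Y, ∃ U, IsOpen U ∧ y ∈ U ∧ ContractibleIn U) {A : Set Y} (hA : IsCompact A)
    {m : ℕ} (hm : essDim A < ((m : ℕ∞) : WithBot ℕ∞)) : lsCat A ≤ m := by
  simp only [essDim, iInf_lt_iff] at hm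
  obtain ⟨B, ⟨f, hf, rfl⟩, hB⟩ := hm
  refine (lsCat_le_of_homotopic hA hf).trans ?_
  have := isCompact_iff_compactSpace.1 hA
  unfold coveringDim at hB
  split_ifs at hB with he
  · have h0 : lsCat (range f) ≤ (0 : ℕ) := by
      refine lsCat_le_of_cover Fin.elim0 (fun j ↦ j.elim0) ?_
      rw [isEmpty_coe_sort.1 he]
      exact empty_subset _
    exact h0.trans (by simp)
  · rw [WithBot.coe_lt_coe] at hB
    simp only [iInf_lt_iff] at hB
    obtain ⟨d, hd, hdm⟩ := hB
    refine (lsCat_le_of_coveringDimLE hloc (isCompact_range f.continuous) hd).trans ?_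
    have : d < m := by exact_mod_cast hdm
    exact_mod_cast this

/-- The category of a compact set is at most its essential dimension plus one. -/
theorem lsCat_le_addOne_essDim [T2Space Y] [PathConnectedSpace Y]
    (hloc : ∀ y : Y, ∃ U, IsOpen U ∧ y ∈ U ∧ ContractibleIn U) {A : Set Y} (hA : IsCompact A) :
    lsCat A ≤ addOne (essDim A) := by
  rcases h : essDim A with _ | (_ | m)
  · refine (lsCat_le_of_essDim_lt hloc hA (m := 0) ?_).trans (by simp)
    rw [h]
    exact WithBot.bot_lt_coe _
  · exact le_top.trans_eq (top_add 1).symm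
  · refine (lsCat_le_of_essDim_lt hloc hA (m := m + 1) ?_).trans_eq (by rfl)
    rw [h]
    exact WithBot.coe_lt_coe.2 (Nat.cast_lt.2 m.lt_succ_self)

end Topological

/-! ### The projective space of the Sobolev space -/

namespace FinslerMeasureManifold

variable {n : ℕ} {H : Type*} [TopologicalSpace H]
  {I : ModelWithCorners ℝ (EuclideanSpace ℝ (Fin n)) H}
  {M : Type*} [TopologicalSpace M] [ChartedSpace H M] [IsManifold I ∞ M]
  [MeasurableSpace M] [BorelSpace M] [CompactSpace M] (𝓜 : FinslerMeasureManifold I M)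

theorem continuous_valL2 : Continuous 𝓜.valL2 :=
  UniformSpace.Completion.continuous_extension

theorem valL2_add (u v : 𝓜.SobolevSpace) : 𝓜.valL2 (u + v) = 𝓜.valL2 u + 𝓜.valL2 v := by
  induction u, v using UniformSpace.Completion.induction_on₂ with
  | hp =>
    have := 𝓜.continuous_valL2
    exact isClosed_eq (by fun_prop) (by fun_prop)
  | ih φ ψ =>
    rw [← UniformSpace.Completion.coe_add, valL2_coe, valL2_coe, valL2_coe, toC_add, map_add]

theorem valL2_smul (c : ℝ) (u : 𝓜.SobolevSpace) : 𝓜.valL2 (c • u) = c • 𝓜.valL2 u := by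
  induction u using UniformSpace.Completion.induction_on with
  | hp =>
    exact isClosed_eq (𝓜.continuous_valL2.comp (continuous_const_smul c))
      (𝓜.continuous_valL2.const_smul c)
  | ih φ =>
    rw [← UniformSpace.Completion.coe_smul, valL2_coe, valL2_coe, toC_smul, map_smul]

/-- The canonical map `𝒳 → L²(M)` as a continuous linear map. -/
noncomputable def valCLM : 𝓜.SobolevSpace →L[ℝ] Lp ℝ 2 𝓜.measure where
  toFun := 𝓜.valL2
  map_add' := 𝓜.valL2_add
  map_smul' := 𝓜.valL2_smul
  cont := 𝓜.continuous_valL2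

theorem integral_valL2_sq (u : 𝓜.SobolevSpace) :
    ∫ x, (𝓜.valL2 u x) ^ 2 ∂𝓜.measure = ‖𝓜.valCLM u‖ ^ 2 := by
  rw [← real_inner_self_eq_norm_sq, L2.inner_def]
  refine integral_congr_ae (ae_of_all _ fun x ↦ ?_)
  exact (sq_abs _).symm.trans (real_inner_self_eq_norm_sq (𝓜.valL2 u x)).symm

theorem norm_valCLM (u : 𝓜.UnitSphere) : ‖𝓜.valCLM u‖ = 1 := by
  have h := u.2
  rw [integral_valL2_sq] at h
  exact (pow_eq_one_iff_of_nonneg (norm_nonneg _) two_ne_zero).1 h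

variable {𝓜} in
/-- The element of `𝒮` on the ray through `w`, for `w` nonzero in `L²(M)`. -/
noncomputable def normalize (w : 𝓜.SobolevSpace) (hw : 𝓜.valCLM w ≠ 0) : 𝓜.UnitSphere :=
  ⟨‖𝓜.valCLM w‖⁻¹ • w, by
    rw [integral_valL2_sq, map_smul, norm_smul, norm_inv, norm_norm,
      inv_mul_cancel₀ (norm_ne_zero_iff.2 hw), one_pow]⟩

open Classical in
variable {𝓜} in
/-- The point of `ℙ(𝒳)` given by the line through `w`, for `w` nonzero in `L²(M)`; for the other
`w` it is the point given by `u₀`. -/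
noncomputable def lineClass (u₀ : 𝓜.UnitSphere) (w : 𝓜.SobolevSpace) : 𝓜.ProjectiveSpace :=
  if hw : 𝓜.valCLM w ≠ 0 then 𝓜.proj (normalize w hw) else 𝓜.proj u₀

theorem isOpenQuotientMap_proj : IsOpenQuotientMap 𝓜.proj := by
  refine ⟨Quotient.mk_surjective, continuous_quotient_mk', fun U hU ↦ ?_⟩
  let σ : 𝓜.UnitSphere → 𝓜.UnitSphere := fun u ↦ ⟨-u, by
    rw [integral_valL2_sq, map_neg, norm_neg, norm_valCLM, one_pow]⟩
  have hσ : Continuous σ := by fun_prop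
  have : 𝓜.proj ⁻¹' (𝓜.proj '' U) = U ∪ σ ⁻¹' U := by
    ext v
    constructor
    · rintro ⟨u, hu, huv⟩
      rcases Quotient.exact huv with h | h
      · exact Or.inl (Subtype.ext h ▸ hu)
      · refine Or.inr ?_
        have : σ v = u := Subtype.ext (by simp [σ, h])
        rwa [mem_preimage, this]
    · rintro (h | h)
      · exact ⟨v, h, rfl⟩
      · exact ⟨σ v, h, Quotient.sound (Or.inr (by simp [σ]))⟩
  change IsOpen (𝓜.proj ⁻¹' (𝓜.proj '' U))
  rw [this]
  exact hU.union (hU.preimage hσ)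

theorem proj_eq_iff {u v : 𝓜.UnitSphere} :
    𝓜.proj u = 𝓜.proj v ↔
      (v : 𝓜.SobolevSpace) = u ∨ (v : 𝓜.SobolevSpace) = -u :=
  Quotient.eq (r := 𝓜.antipodal)

instance : T2Space 𝓜.ProjectiveSpace := by
  rw [t2Space_iff_of_isOpenQuotientMap 𝓜.isOpenQuotientMap_proj]
  have : {q : 𝓜.UnitSphere × 𝓜.UnitSphere | 𝓜.proj q.1 = 𝓜.proj q.2} =
      {q | (q.2 : 𝓜.SobolevSpace) = q.1} ∪ {q | (q.2 : 𝓜.SobolevSpace) = -q.1} := by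
    ext q
    exact 𝓜.proj_eq_iff
  rw [this]
  exact (isClosed_eq (by fun_prop) (by fun_prop)).union
    (isClosed_eq (by fun_prop) (by fun_prop))

theorem lineClass_neg (u₀ : 𝓜.UnitSphere) (w : 𝓜.SobolevSpace) :
    lineClass u₀ (-w) = lineClass u₀ w := by
  unfold lineClass
  by_cases hw : 𝓜.valCLM w ≠ 0
  · have hw' : 𝓜.valCLM (-w) ≠ 0 := by rwa [map_neg, neg_ne_zero]
    rw [dif_pos hw, dif_pos hw', proj_eq_iff]
    right
    simp [normalize]
  · have hw' : ¬ 𝓜.valCLM (-w) ≠ 0 := by rwa [map_neg, neg_ne_zero]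
    rw [dif_neg hw, dif_neg hw']

theorem lineClass_smul (u₀ u : 𝓜.UnitSphere) {c : ℝ} (hc : c ≠ 0) :
    lineClass u₀ (c • (u : 𝓜.SobolevSpace)) = 𝓜.proj u := by
  wlog hpos : 0 < c generalizing c
  · rw [← lineClass_neg, ← neg_smul]
    exact this (neg_ne_zero.2 hc) (neg_pos.2 (lt_of_le_of_ne (not_lt.1 hpos) hc))
  have hn : ‖𝓜.valCLM (c • (u : 𝓜.SobolevSpace))‖ = c := by
    rw [map_smul, norm_smul, norm_valCLM, mul_one, Real.norm_of_nonneg hpos.le]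
  have hw : 𝓜.valCLM (c • (u : 𝓜.SobolevSpace)) ≠ 0 := norm_ne_zero_iff.1 (by rwa [hn])
  rw [lineClass, dif_pos hw]
  congr 1
  refine Subtype.ext ?_
  simp only [normalize, hn]
  rw [smul_smul, inv_mul_cancel₀ hc, one_smul]

theorem lineClass_coe (u₀ u : 𝓜.UnitSphere) :
    lineClass u₀ (u : 𝓜.SobolevSpace) = 𝓜.proj u := by
  simpa using 𝓜.lineClass_smul u₀ u one_ne_zero

theorem continuousAt_lineClass (u₀ : 𝓜.UnitSphere) {w : 𝓜.SobolevSpace}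
    (hw : 𝓜.valCLM w ≠ 0) : ContinuousAt (lineClass u₀) w := by
  have hopen : IsOpen {w : 𝓜.SobolevSpace | 𝓜.valCLM w ≠ 0} :=
    isOpen_ne_fun 𝓜.valCLM.continuous continuous_const
  refine ContinuousOn.continuousAt (s := {w | 𝓜.valCLM w ≠ 0}) ?_ (hopen.mem_nhds hw)
  rw [continuousOn_iff_continuous_domRestrict]
  have h1 : Continuous fun w : {w : 𝓜.SobolevSpace | 𝓜.valCLM w ≠ 0} ↦ normalize w.1 w.2 := by
    refine Continuous.subtype_mk ?_ _
    refine Continuous.smul (Continuous.inv₀ (by fun_prop) fun w ↦ norm_ne_zero_iff.2 w.2) ?_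
    fun_prop
  convert 𝓜.isOpenQuotientMap_proj.continuous.comp h1 using 1
  ext w
  have hw' : 𝓜.valCLM w.1 ≠ 0 := w.2
  simp only [domRestrict_apply, lineClass, dif_pos hw', Function.comp_apply]

open scoped InnerProductSpace

/-- A segment between two points of `𝒮` with nonnegative inner product avoids the kernel of
`𝒳 → L²(M)`; replacing one point by its antipode, any two points of `ℙ(𝒳)` are so joined. -/
theorem joined_proj (u v : 𝓜.UnitSphere) : Joined (𝓜.proj u) (𝓜.proj v) := by
  have key : ∀ w : 𝓜.UnitSphere, 0 ≤ ⟪𝓜.valCLM u, 𝓜.valCLM w⟫_ℝ →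
      Joined (𝓜.proj u) (𝓜.proj w) := by
    intro w hw
    have hne : ∀ t : unitInterval, 𝓜.valCLM ((1 - (t : ℝ)) • (u : 𝓜.SobolevSpace) + (t : ℝ) • w) ≠ 0 := by
      intro t h
      have h2 : ‖𝓜.valCLM ((1 - (t : ℝ)) • (u : 𝓜.SobolevSpace) + (t : ℝ) • w)‖ ^ 2 = 0 := by
        simp [h]
      rw [map_add, map_smul, map_smul, norm_add_sq_real, norm_smul, norm_smul, norm_valCLM,
        norm_valCLM, real_inner_smul_left, real_inner_smul_right, mul_one, mul_one,
        Real.norm_eq_abs, Real.norm_eq_abs, sq_abs, sq_abs] at h2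
      have h3 : 0 ≤ (1 - (t : ℝ)) * (t * ⟪𝓜.valCLM u, 𝓜.valCLM w⟫_ℝ) :=
        mul_nonneg (by linarith [t.2.2]) (mul_nonneg t.2.1 hw)
      nlinarith [sq_nonneg ((t : ℝ) - 1 / 2)]
    refine ⟨{ toFun := fun t ↦ lineClass u
                ((1 - (t : ℝ)) • (u : 𝓜.SobolevSpace) + (t : ℝ) • w)
              continuous_toFun := continuous_iff_continuousAt.2 fun t ↦
                ContinuousAt.comp (f := fun t : unitInterval ↦ (1 - (t : ℝ)) • (u : 𝓜.SobolevSpace) +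
                  (t : ℝ) • (w : 𝓜.SobolevSpace))
                  (𝓜.continuousAt_lineClass u (hne t)) (by fun_prop)
              source' := by simp [lineClass_coe]
              target' := by simp [lineClass_coe] }⟩
  rcases le_total 0 ⟪𝓜.valCLM u, 𝓜.valCLM v⟫_ℝ with h | h
  · exact key v h
  · let v' : 𝓜.UnitSphere := ⟨-v, by
      rw [integral_valL2_sq, map_neg, norm_neg, norm_valCLM, one_pow]⟩
    have hv : 𝓜.proj v' = 𝓜.proj v := 𝓜.proj_eq_iff.2 (Or.inr (by simp [v']))
    rw [← hv]
    exact key v' (by simpa [v', inner_neg_right] using h)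

theorem pathConnectedSpace_projectiveSpace (u : 𝓜.UnitSphere) :
    PathConnectedSpace 𝓜.ProjectiveSpace where
  nonempty := ⟨𝓜.proj u⟩
  joined := by
    rintro ⟨u⟩ ⟨v⟩
    exact 𝓜.joined_proj u v

/-- The lines not orthogonal to `u` in `L²(M)` form an open neighbourhood of `[u]`. It contracts
in `ℙ(𝒳)` to `[u]` along `[(1 - t) v + t ⟨v, u⟩ u]`, which is well defined since the bracket is
odd in `v`, and whose inner product with `u` is constantly `⟨v, u⟩ ≠ 0`. -/
theorem exists_open_contractibleIn (y : 𝓜.ProjectiveSpace) :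
    ∃ U, IsOpen U ∧ y ∈ U ∧ ContractibleIn U := by
  obtain ⟨u, rfl⟩ := 𝓜.isOpenQuotientMap_proj.surjective y
  have := 𝓜.pathConnectedSpace_projectiveSpace u
  let W : Set 𝓜.UnitSphere := {v | ⟪𝓜.valCLM v, 𝓜.valCLM u⟫_ℝ ≠ 0}
  have hW : IsOpen W := by
    have := 𝓜.valCLM.continuous
    exact isOpen_ne_fun (by fun_prop) continuous_const
  let g : 𝓜.SobolevSpace → ℝ → 𝓜.SobolevSpace := fun v t ↦
    (1 - t) • v + (t * ⟪𝓜.valCLM v, 𝓜.valCLM u⟫_ℝ) • (u : 𝓜.SobolevSpace)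
  have hg : Continuous fun z : 𝓜.SobolevSpace × ℝ ↦ g z.1 z.2 := by
    have := 𝓜.valCLM.continuous
    fun_prop
  have hg_neg : ∀ v t, g (-v) t = -g v t := by
    intro v t
    simp only [g, map_neg, inner_neg_left, mul_neg, neg_smul, smul_neg]
    abel
  have hg_ne : ∀ v ∈ W, ∀ t, 𝓜.valCLM (g v t) ≠ 0 := by
    intro v hv t h
    have h1 : ⟪𝓜.valCLM (g v t), 𝓜.valCLM u⟫_ℝ = ⟪𝓜.valCLM v, 𝓜.valCLM u⟫_ℝ := by
      rw [map_add, map_smul, map_smul, inner_add_left, real_inner_smul_left,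
        real_inner_smul_left, real_inner_self_eq_norm_sq, norm_valCLM]
      ring
    rw [h, inner_zero_left] at h1
    exact hv h1.symm
  obtain ⟨G, hG⟩ : ∃ G : 𝓜.ProjectiveSpace × unitInterval → 𝓜.ProjectiveSpace,
      ∀ (v : 𝓜.UnitSphere) (t : unitInterval), G (𝓜.proj v, t) = lineClass u (g v t) :=
    ⟨fun z ↦ Quotient.lift (s := 𝓜.antipodal)
      (fun v : 𝓜.UnitSphere ↦ lineClass u (g v z.2)) (by
        rintro v w (h | h)
        · simp only [h]
        · simp only [h, hg_neg, lineClass_neg]) z.1, fun _ _ ↦ rfl⟩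
  refine ⟨𝓜.proj '' W, 𝓜.isOpenQuotientMap_proj.isOpenMap W hW, ⟨u, ?_, rfl⟩,
    (contractibleIn_iff_continuousOn (𝓜.proj u)).2 ⟨G, ?_, ?_, ?_⟩⟩
  · change ⟪𝓜.valCLM u, 𝓜.valCLM u⟫_ℝ ≠ 0
    simp [norm_valCLM]
  · rintro ⟨_, t⟩ ⟨⟨v, hv, rfl⟩, -⟩
    refine ContinuousAt.continuousWithinAt ?_
    have hq := 𝓜.isOpenQuotientMap_proj.prodMap (IsOpenQuotientMap.id (X := unitInterval))
    have hcomp : G ∘ Prod.map 𝓜.proj id =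
        lineClass u ∘ fun z : 𝓜.UnitSphere × unitInterval ↦ g z.1 z.2 :=
      funext fun z ↦ hG z.1 z.2
    have hgc : Continuous fun z : 𝓜.UnitSphere × unitInterval ↦ g z.1 z.2 :=
      hg.comp (f := fun z : 𝓜.UnitSphere × unitInterval ↦
        ((z.1 : 𝓜.SobolevSpace), (z.2 : ℝ))) (by fun_prop)
    have h1 : ContinuousAt (G ∘ Prod.map 𝓜.proj id) (v, t) := by
      rw [hcomp]
      exact ContinuousAt.comp (𝓜.continuousAt_lineClass u (hg_ne v hv t)) hgc.continuousAt
    exact hq.continuousAt_comp_iff.1 h1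
  · rintro _ ⟨v, -, rfl⟩
    rw [hG]
    simp [g, lineClass_coe]
  · rintro _ ⟨v, hv, rfl⟩
    rw [hG]
    simpa [g] using 𝓜.lineClass_smul u u hv

/-! ### Comparison of the dimensions and of the eigenvalues -/

theorem dimLS_le_dimES {A : Set 𝓜.UnitSphere} (hA : IsCompact A) : 𝓜.dimLS A ≤ 𝓜.dimES A := by
  rcases isEmpty_or_nonempty 𝓜.UnitSphere with h | ⟨⟨u⟩⟩
  · have : lsCat (𝓜.proj '' A) ≤ (0 : ℕ) := by
      refine lsCat_le_of_cover Fin.elim0 (fun j ↦ j.elim0) ?_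
      rw [eq_empty_of_isEmpty A, image_empty]
      exact empty_subset _
    exact this.trans (by simp)
  · have := 𝓜.pathConnectedSpace_projectiveSpace u
    exact lsCat_le_addOne_essDim 𝓜.exists_open_contractibleIn
      (hA.image 𝓜.isOpenQuotientMap_proj.continuous)

/-- A pair with fewer sets or a smaller dimension has larger eigenvalues. -/
theorem eigenvalue_le_eigenvalue {𝒞 𝒞' : Set (Set 𝓜.UnitSphere)}
    {Dim Dim' : Set 𝓜.UnitSphere → ℕ∞} (h𝒞 : 𝒞' ⊆ 𝒞) (hDim : ∀ A ∈ 𝒞', Dim' A ≤ Dim A) (k : ℕ) :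
    𝓜.eigenvalue 𝒞 Dim k ≤ 𝓜.eigenvalue 𝒞' Dim' k := by
  have h : ∀ c, 𝓜.dimSublevel 𝒞' Dim' c ≤ 𝓜.dimSublevel 𝒞 Dim c := fun c ↦
    iSup₂_le fun A hA ↦ (hDim A hA.1).trans
      (le_iSup₂ (f := fun A (_ : A ∈ {A ∈ 𝒞 | ∀ u ∈ A, ENNReal.ofReal (𝓜.energy u) ≤ c}) ↦ Dim A)
        A ⟨h𝒞 hA.1, hA.2⟩)
  refine sSup_le_sSup fun c hc ↦ ?_
  rw [mem_ofPred_eq] at hc ⊢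
  exact (h c).trans_lt hc

end FinslerMeasureManifold

theorem mainTheorem12 {n : ℕ} {H : Type*} [TopologicalSpace H]
    {I : ModelWithCorners ℝ (EuclideanSpace ℝ (Fin n)) H}
    {M : Type*} [TopologicalSpace M] [ChartedSpace H M] [IsManifold I ∞ M]
    [T2Space M] [CompactSpace M] [ConnectedSpace M] [MeasurableSpace M] [BorelSpace M]
    (𝓜 : FinslerMeasureManifold I M) (k : ℕ) (hk : 1 ≤ k) :
    min (𝓜.eigenvalue 𝓜.closedFamily 𝓜.dimLS k) (𝓜.eigenvalue 𝓜.closedFamily 𝓜.dimES k) ≤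
        𝓜.eigenvalue 𝓜.compactFamily 𝓜.dimES k ∧
      𝓜.eigenvalue 𝓜.compactFamily 𝓜.dimES k ≤ 𝓜.eigenvalue 𝓜.compactFamily 𝓜.dimLS k := by
  refine ⟨(min_le_right _ _).trans (𝓜.eigenvalue_le_eigenvalue ?_ (fun _ _ ↦ le_rfl) k),
    𝓜.eigenvalue_le_eigenvalue subset_rfl (fun A hA ↦ 𝓜.dimLS_le_dimES hA) k⟩
  exact fun A hA ↦ IsCompact.isClosed hA
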